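/- Let $X$ be a locally compact regular topological space (every point has a compact neighbourhood; $X$ is not assumed Hausdorff), let $(\mu_\alpha)$ be a net of Borel probability measures on $X$, and let $(t_\alpha)$ be a net (over the same directed set) in $]0,+\infty[$ converging to $0$. Write $\mu_\alpha^{t_\alpha}(B)=(\mu_\alpha(B))^{t_\alpha}$ for Borel sets $B$, and, for a real-valued Borel function $h$ on $X$, put $\mu_\alpha^{t_\alpha}(e^{h/t_\alpha})=\big(\int_X e^{h(x)/t_\alpha}\mu_\alpha(dx)\big)^{t_\alpha}$ and $\Lambda(h)=\log\lim_\alpha\mu_\alpha^{t_\alpha}(e^{h/t_\alpha})\in[-\infty,+\infty]$ when this limit exists. For $l:X\to[0,+\infty]$ consider the bounds $$\text{(U)}\quad \limsup_\alpha\mu_\alpha^{t_\alpha}(F)\le\sup_{x\in F}e^{-l(x)},\qquad\qquad \text{(L)}\quad \sup_{x\in G}e^{-l(x)}\le\liminf_\alpha\mu_\alpha^{t_\alpha}(G).$$ The net $(\mu_\alpha)$ satisfies a large deviation principle (resp. a vague large deviation principle) with powers $(t_\alpha)$ and rate function $J$ if, for some $l:X\to[0,+\infty]$ whose lower regularization (the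 greatest lower semicontinuous function $\le l$) is $J$, (U) holds for all closed $F$ (resp. all compact $F$) and (L) holds for all open $G$. It is exponentially tight with respect to $(t_\alpha)$ if for every $\varepsilon>0$ there is a compact $K\subset X$ with $\limsup_\alpha\mu_\alpha^{t_\alpha}(X\setminus K)<\varepsilon$. Let $\mathcal A$ be an algebra (not necessarily unital) of real-valued continuous functions on $X$ vanishing at infinity, which separates the points of $X$ (for $x\ne y$ there is $h\in\mathcal A$ with $h(x)\ne h(y)$) and does not vanish identically at any point (for every $x$ there is $h\in\mathcal A$ with $h(x)\neq0$). Assume that $\Lambda(h)$ exists for every $h\in\mathcal A$, and put $$J(x)=\sup_{h\in\mathcal A}\{h(x)-\Lambda(h)\}\quad (x\in X).$$ Consider the conditions $$(1)\quad \sup_{h\in\mathcal A}\{-\Lambda(h)\}\ \ge\ \sup_{x\in X,\,h\in\mathcal A}\{h(x)-\Lambda(h)\},\qquad\qquad (2)\quad \sup_{K\subset X\text{ compact}}\ \inf_{x\in X\setminus K}J(x)\ \ge\ \sup_{x\in X}J(x),$$ where $\inf\emptyset=+\infty$. Then: (a) $(\mu_\alpha)$ satisfies a vague large deviation principle with powers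 $(t_\alpha)$ and rate function $J$. If moreover (1) holds, then $(\mu_\alpha)$ satisfies a large deviation principle with powers $(t_\alpha)$ and rate function $J$, and (2) holds. (b) If $X$ is Hausdorff and $(\mu_\alpha)$ satisfies a large deviation principle with powers $(t_\alpha)$ and some rate function, then that rate function is $J$, and (2) implies (1). (c) $(\mu_\alpha)$ is exponentially tight with respect to $(t_\alpha)$ if and only if $\sup_{h\in\mathcal A}\{-\Lambda(h)\}=+\infty$. -/

import Mathlib

open Filter Topology MeasureTheory Set
open scoped ENNReal ZeroAtInfty

noncomputable section

namespace LargeDev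

/-! Throughout, `μ : ι → Measure X` is a net of Borel probability measures indexed by a directed
set `ι`, and `t : ι → ℝ` is a net of positive reals converging to `0`; upper and lower limits of
nets are taken along `atTop`. -/

/-- `μ_α^{t_α}(e^{h/t_α}) = (∫ e^{h(x)/t_α} μ_α(dx))^{t_α}`, an element of `[0,∞]`. -/
def expMoment {X ι : Type*} [MeasurableSpace X] (μ : ι → Measure X) (t : ι → ℝ)
    (h : X → ℝ) (i : ι) : ℝ≥0∞ :=
  (∫⁻ x, ENNReal.ofReal (Real.exp (h x / t i)) ∂(μ i)) ^ (t i)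

/-- `Λ(h)` exists (in `[-∞,∞]`): the net `μ_α^{t_α}(e^{h/t_α})` has a limit in `[0,∞]`. -/
def LambdaExists {X ι : Type*} [MeasurableSpace X] [Preorder ι] (μ : ι → Measure X) (t : ι → ℝ)
    (h : X → ℝ) : Prop :=
  ∃ L : ℝ≥0∞, Tendsto (expMoment μ t h) atTop (𝓝 L)

/-- `Λ(h) = log lim μ_α^{t_α}(e^{h/t_α})`; only meaningful when `LambdaExists μ t h`. -/
def Lambda {X ι : Type*} [MeasurableSpace X] [Preorder ι] (μ : ι → Measure X) (t : ι → ℝ)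
    (h : X → ℝ) : EReal :=
  ENNReal.log (limUnder atTop (expMoment μ t h))

/-- When the limit exists, `Λ(h)` is its logarithm. -/
theorem Lambda_eq_of_tendsto {X ι : Type*} [MeasurableSpace X] [Preorder ι] [IsDirectedOrder ι]
    [Nonempty ι] {μ : ι → Measure X} {t : ι → ℝ} {h : X → ℝ} {L : ℝ≥0∞}
    (hL : Tendsto (expMoment μ t h) atTop (𝓝 L)) : Lambda μ t h = ENNReal.log L := by
  rw [Lambda, hL.limUnder_eq]

/-- Upper bounds with function `l`, over the class `S` of test sets:
`limsup μ_α^{t_α}(F) ≤ sup_{x ∈ F} e^{-l(x)}` for all `F ∈ S`. -/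
def UpperBounds {X ι : Type*} [MeasurableSpace X] [Preorder ι] (μ : ι → Measure X) (t : ι → ℝ)
    (S : Set (Set X)) (l : X → ℝ≥0∞) : Prop :=
  ∀ F ∈ S, limsup (fun i => (μ i F) ^ (t i)) atTop ≤ ⨆ x ∈ F, EReal.exp (-(l x : EReal))

/-- Lower bounds with function `l`:
`sup_{x ∈ G} e^{-l(x)} ≤ liminf μ_α^{t_α}(G)` for all open `G`. -/
def LowerBounds {X ι : Type*} [TopologicalSpace X] [MeasurableSpace X] [Preorder ι]
    (μ : ι → Measure X) (t : ι → ℝ) (l : X → ℝ≥0∞) : Prop :=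
  ∀ G : Set X, IsOpen G →
    ⨆ x ∈ G, EReal.exp (-(l x : EReal)) ≤ liminf (fun i => (μ i G) ^ (t i)) atTop

/-- `J` is the lower-regularization of `l`: the greatest lower semicontinuous function below
`l`. -/
def IsLowerRegularization {X : Type*} [TopologicalSpace X] (J : X → EReal) (l : X → ℝ≥0∞) :
    Prop :=
  IsGreatest {g : X → EReal | LowerSemicontinuous g ∧ ∀ x, g x ≤ (l x : EReal)} J

/-- Large deviation principle with powers `t` and rate function `J`: upper bounds on closed sets
and lower bounds on open sets hold with some `[0,∞]`-valued function whose lower-regularization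
is `J`. -/
def LDP {X ι : Type*} [TopologicalSpace X] [MeasurableSpace X] [Preorder ι]
    (μ : ι → Measure X) (t : ι → ℝ) (J : X → EReal) : Prop :=
  ∃ l : X → ℝ≥0∞, UpperBounds μ t {F | IsClosed F} l ∧ LowerBounds μ t l ∧
    IsLowerRegularization J l

/-- Vague large deviation principle with powers `t` and rate function `J`: as `LDP`, with the
upper bounds on compact sets only. -/
def VagueLDP {X ι : Type*} [TopologicalSpace X] [MeasurableSpace X] [Preorder ι]
    (μ : ι → Measure X) (t : ι → ℝ) (J : X → EReal) : Prop :=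
  ∃ l : X → ℝ≥0∞, UpperBounds μ t {K | IsCompact K} l ∧ LowerBounds μ t l ∧
    IsLowerRegularization J l

/-- Exponential tightness of `μ` with respect to `t`. -/
def ExpTight {X ι : Type*} [TopologicalSpace X] [MeasurableSpace X] [Preorder ι]
    (μ : ι → Measure X) (t : ι → ℝ) : Prop :=
  ∀ ε : ℝ≥0∞, 0 < ε → ∃ K : Set X, IsCompact K ∧
    limsup (fun i => (μ i Kᶜ) ^ (t i)) atTop < ε

/-- `J(x) = sup_{h ∈ A} (h(x) - Λ(h))`. -/
def rateFun {X ι : Type*} [TopologicalSpace X] [MeasurableSpace X] [Preorder ι]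
    (μ : ι → Measure X) (t : ι → ℝ) (A : NonUnitalSubalgebra ℝ C₀(X, ℝ)) (x : X) : EReal :=
  ⨆ h ∈ A, ((h x : EReal) - Lambda μ t h)

/-- `sup_{h ∈ A} (-Λ(h)) ≥ sup_{x ∈ X, h ∈ A} (h(x) - Λ(h))`. -/
def SupCondition {X ι : Type*} [TopologicalSpace X] [MeasurableSpace X] [Preorder ι]
    (μ : ι → Measure X) (t : ι → ℝ) (A : NonUnitalSubalgebra ℝ C₀(X, ℝ)) : Prop :=
  ⨆ x : X, ⨆ h ∈ A, ((h x : EReal) - Lambda μ t h) ≤ ⨆ h ∈ A, -Lambda μ t h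

/-- `sup_{K compact} inf_{x ∈ X \ K} J(x) ≥ sup_{x ∈ X} J(x)`, with `inf ∅ = +∞`. -/
def WeakTight {X : Type*} [TopologicalSpace X] (J : X → EReal) : Prop :=
  ⨆ x : X, J x ≤ ⨆ K ∈ {K : Set X | IsCompact K}, ⨅ x ∈ Kᶜ, J x

end LargeDev

end

/-! Since `A` separates points by continuous functions, X is Hausdorff, and by Stone-Weierstrass `A`
is uniformly dense in C₀(X). As Λ is 1-Lipschitz for the sup norm, Λ exists on all of C₀(X) and the
suprema defining `rateFun` and sup(-Λ) do not change when `A` is replaced by C₀(X)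
(`LambdaExists.of_approx`, `biSup_sub_Lambda_eq_iSup`).

There `fullRate` is the decay rate of mass near a point, and `escapeRate` is its analogue at
infinity. Chebyshev's inequality bounds from above the mass of some neighbourhood of x, or of the
complement of some compact set. Multiples of bump functions bound from below the mass of every such
set. Since 2^{t_α} → 1, a finite sum behaves like a maximum, so compactness turns the local upper
bounds into bounds on compact sets. If `fullRate` ≤ `escapeRate`, what lies outside a large compact
set is negligible, and closed sets follow. Comparing these bounds with those of a given principle
yields (b), and (c) says that the escape rate is infinite. -/

namespace LargeDev

/-! ### Sums under vanishing powers -/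

section Powers

variable {ι : Type*} [Preorder ι] {t : ι → ℝ}

theorem tendsto_two_rpow_mul (ht : Tendsto t atTop (𝓝 0)) {C : ℝ≥0∞} :
    Tendsto (fun i => (2 : ℝ≥0∞) ^ t i * C) atTop (𝓝 C) := by
  have h : Tendsto (fun i => (2 : ℝ≥0∞) ^ t i) atTop (𝓝 1) := by
    have h1 : Tendsto (fun i => ENNReal.ofReal ((2 : ℝ) ^ t i)) atTop (𝓝 1) := by
      have h2 : Tendsto (fun i => (2 : ℝ) ^ t i) atTop (𝓝 ((2 : ℝ) ^ (0 : ℝ))) :=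
        tendsto_const_nhds.rpow ht (Or.inl two_ne_zero)
      rw [Real.rpow_zero] at h2
      simpa using ENNReal.tendsto_ofReal h2
    refine h1.congr fun i => ?_
    rw [← ENNReal.ofReal_rpow_of_pos two_pos]
    simp
  simpa using ENNReal.Tendsto.mul_const h (Or.inl one_ne_zero)

theorem add_rpow_le_two_rpow_mul {a b C : ℝ≥0∞} {s : ℝ} (hs : 0 < s) (ha : a ^ s ≤ C)
    (hb : b ^ s ≤ C) : (a + b) ^ s ≤ 2 ^ s * C := by
  have key : ∀ c : ℝ≥0∞, c ^ s ≤ C → c ≤ C ^ (1 / s) := fun c hc => by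
    rwa [one_div, ENNReal.le_rpow_inv_iff hs]
  calc (a + b) ^ s ≤ (2 * C ^ (1 / s)) ^ s := by
        rw [two_mul]
        exact ENNReal.rpow_le_rpow (add_le_add (key a ha) (key b hb)) hs.le
    _ = 2 ^ s * C := by
        rw [ENNReal.mul_rpow_of_nonneg _ _ hs.le, ← ENNReal.rpow_mul, one_div,
          inv_mul_cancel₀ hs.ne', ENNReal.rpow_one]

/-- A sum costs only the factor 2^{t_α} → 1 over the maximum of its terms. -/
theorem limsup_add_rpow_le [IsDirectedOrder ι] [Nonempty ι] (ht_pos : ∀ i, 0 < t i)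
    (ht : Tendsto t atTop (𝓝 0)) {a b : ι → ℝ≥0∞} {C : ℝ≥0∞}
    (ha : limsup (fun i => a i ^ t i) atTop ≤ C) (hb : limsup (fun i => b i ^ t i) atTop ≤ C) :
    limsup (fun i => (a i + b i) ^ t i) atTop ≤ C := by
  refine le_of_forall_gt_imp_ge_of_dense fun D hD => ?_
  rw [← (tendsto_two_rpow_mul ht (C := D)).limsup_eq]
  refine limsup_le_limsup ?_
  filter_upwards [eventually_lt_of_limsup_lt (ha.trans_lt hD),
    eventually_lt_of_limsup_lt (hb.trans_lt hD)] with i h1 h2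
  exact add_rpow_le_two_rpow_mul (ht_pos i) h1.le h2.le

theorem ofReal_exp_div_rpow {a s : ℝ} (hs : 0 < s) :
    ENNReal.ofReal (Real.exp (a / s)) ^ s = EReal.exp a := by
  rw [ENNReal.ofReal_rpow_of_pos (Real.exp_pos _), ← Real.exp_mul, div_mul_cancel₀ _ hs.ne',
    EReal.exp_coe]

end Powers

/-! ### Exponential moments and Λ -/

section Moments

variable {X ι : Type*} [MeasurableSpace X] {μ : ι → Measure X} {t : ι → ℝ}

theorem expMoment_le_mul (ht_pos : ∀ i, 0 < t i) {h g : X → ℝ} {c : ℝ}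
    (hgc : ∀ x, h x ≤ c + g x) (i : ι) :
    expMoment μ t h i ≤ EReal.exp c * expMoment μ t g i := by
  have hs := ht_pos i
  rw [← ofReal_exp_div_rpow hs, expMoment, expMoment, ← ENNReal.mul_rpow_of_nonneg _ _ hs.le,
    ← lintegral_const_mul' _ _ ENNReal.ofReal_ne_top]
  refine ENNReal.rpow_le_rpow (lintegral_mono fun x => ?_) hs.le
  rw [← ENNReal.ofReal_mul (Real.exp_pos _).le, ← Real.exp_add, ← add_div]
  exact ENNReal.ofReal_le_ofReal (Real.exp_le_exp.2 (div_le_div_of_nonneg_right (hgc x) hs.le))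

theorem exp_mul_measure_rpow_le_expMoment (ht_pos : ∀ i, 0 < t i) {h : X → ℝ} {a : ℝ} {B : Set X}
    (hB : MeasurableSet B) (ha : ∀ x ∈ B, a ≤ h x) (i : ι) :
    EReal.exp a * μ i B ^ t i ≤ expMoment μ t h i := by
  have hs := ht_pos i
  rw [← ofReal_exp_div_rpow hs, expMoment, ← ENNReal.mul_rpow_of_nonneg _ _ hs.le]
  refine ENNReal.rpow_le_rpow ?_ hs.le
  calc _ = ∫⁻ _ in B, ENNReal.ofReal (Real.exp (a / t i)) ∂(μ i) := by simp
    _ ≤ ∫⁻ x in B, ENNReal.ofReal (Real.exp (h x / t i)) ∂(μ i) :=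
        setLIntegral_mono' hB fun x hx => ENNReal.ofReal_le_ofReal
          (Real.exp_le_exp.2 (div_le_div_of_nonneg_right (ha x hx) hs.le))
    _ ≤ _ := setLIntegral_le_lintegral _ _

/-- The threshold e^{b-a} makes `B` contribute at most e^a · e^{b-a} = e^b, the same as its
complement. -/
theorem expMoment_le_two_rpow_mul [∀ i, IsProbabilityMeasure (μ i)] (ht_pos : ∀ i, 0 < t i)
    {h : X → ℝ} {a b : ℝ} {B : Set X} (ha : ∀ x ∈ B, h x ≤ a) (hb : ∀ x ∉ B, h x ≤ b) {i : ι}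
    (hi : μ i B ^ t i ≤ EReal.exp ((b - a : ℝ) : EReal)) :
    expMoment μ t h i ≤ 2 ^ t i * EReal.exp b := by
  have hs := ht_pos i
  have h1 : ∫⁻ x, ENNReal.ofReal (Real.exp (h x / t i)) ∂(μ i) ≤
      ENNReal.ofReal (Real.exp (a / t i)) * μ i B + ENNReal.ofReal (Real.exp (b / t i)) := by
    calc _ ≤ ∫⁻ x, (B.indicator (fun _ => ENNReal.ofReal (Real.exp (a / t i))) x +
          ENNReal.ofReal (Real.exp (b / t i))) ∂(μ i) := by
          refine lintegral_mono fun x => ?_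
          by_cases hx : x ∈ B
          · simp only [hx, indicator_of_mem]
            exact le_add_right (ENNReal.ofReal_le_ofReal
              (Real.exp_le_exp.2 (div_le_div_of_nonneg_right (ha x hx) hs.le)))
          · simp only [hx, not_false_eq_true, indicator_of_notMem, zero_add]
            exact ENNReal.ofReal_le_ofReal
              (Real.exp_le_exp.2 (div_le_div_of_nonneg_right (hb x hx) hs.le))
      _ ≤ _ := by
          rw [lintegral_add_right _ measurable_const]
          exact add_le_add (lintegral_indicator_const_le _ _) (by simp)
  refine (ENNReal.rpow_le_rpow h1 hs.le).trans (add_rpow_le_two_rpow_mul hs ?_ ?_)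
  · rw [ENNReal.mul_rpow_of_nonneg _ _ hs.le, ofReal_exp_div_rpow hs]
    calc _ ≤ EReal.exp a * EReal.exp ((b - a : ℝ) : EReal) := by gcongr
      _ = EReal.exp b := by
        rw [← EReal.exp_add, ← EReal.coe_add]
        simp
  · exact (ofReal_exp_div_rpow hs).le

variable [Preorder ι] [IsDirectedOrder ι] [Nonempty ι]

theorem LambdaExists.tendsto {h : X → ℝ} (hL : LambdaExists μ t h) :
    Tendsto (expMoment μ t h) atTop (𝓝 (EReal.exp (Lambda μ t h))) := by
  obtain ⟨L, hL⟩ := hL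
  rwa [Lambda_eq_of_tendsto hL, ENNReal.exp_log]

theorem Lambda_le_add (ht_pos : ∀ i, 0 < t i) {h g : X → ℝ} {c : ℝ} (hh : LambdaExists μ t h)
    (hg : LambdaExists μ t g) (hgc : ∀ x, h x ≤ c + g x) :
    Lambda μ t h ≤ c + Lambda μ t g := by
  rw [← EReal.exp_le_exp_iff, EReal.exp_add]
  refine le_of_tendsto_of_tendsto' hh.tendsto
    (ENNReal.Tendsto.const_mul hg.tendsto (Or.inr (by simp))) fun i => ?_
  exact expMoment_le_mul ht_pos hgc i

theorem Lambda_zero [∀ i, IsProbabilityMeasure (μ i)] : Lambda μ t (fun _ => 0) = 0 := by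
  rw [Lambda_eq_of_tendsto (L := 1) (tendsto_const_nhds.congr fun i => by simp [expMoment]),
    ENNReal.log_one]

theorem LambdaExists.of_approx (ht_pos : ∀ i, 0 < t i) {h : X → ℝ}
    (happ : ∀ ε : ℝ, 0 < ε → ∃ g : X → ℝ, LambdaExists μ t g ∧ ∀ x, |h x - g x| ≤ ε) :
    LambdaExists μ t h := by
  refine ⟨limsup (expMoment μ t h) atTop, tendsto_of_le_liminf_of_limsup_le ?_ le_rfl⟩
  -- One ε is lost in passing from `h` to `g`, another in returning.
  have key : ∀ ε : ℝ, 0 < ε → limsup (expMoment μ t h) atTop ≤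
      EReal.exp ((2 * ε : ℝ) : EReal) * liminf (expMoment μ t h) atTop := by
    intro ε hε
    obtain ⟨g, hg, hgx⟩ := happ ε hε
    have h1 : limsup (expMoment μ t h) atTop ≤ EReal.exp ε * EReal.exp (Lambda μ t g) := by
      rw [← hg.tendsto.limsup_eq, ← ENNReal.limsup_const_mul_of_ne_top (by simp)]
      exact limsup_le_limsup (Eventually.of_forall
        (expMoment_le_mul ht_pos fun x => by linarith [(abs_le.1 (hgx x)).2]))
    have h2 : EReal.exp (Lambda μ t g) ≤ EReal.exp ε * liminf (expMoment μ t h) atTop := by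
      have h3 : EReal.exp ((-ε : ℝ) : EReal) * EReal.exp (Lambda μ t g) ≤
          liminf (expMoment μ t h) atTop := by
        rw [← (ENNReal.Tendsto.const_mul hg.tendsto (Or.inr (by simp))).liminf_eq]
        refine liminf_le_liminf (Eventually.of_forall fun i => ?_)
        calc _ ≤ EReal.exp ((-ε : ℝ) : EReal) * (EReal.exp ε * expMoment μ t h i) := by
              gcongr
              exact expMoment_le_mul ht_pos (fun x => by linarith [(abs_le.1 (hgx x)).1]) i
          _ = _ := by
              rw [← mul_assoc, ← EReal.exp_add, ← EReal.coe_add]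
              simp
      calc _ = EReal.exp ε * (EReal.exp ((-ε : ℝ) : EReal) * EReal.exp (Lambda μ t g)) := by
              rw [← mul_assoc, ← EReal.exp_add, ← EReal.coe_add]
              simp
        _ ≤ _ := by gcongr
    calc _ ≤ _ := h1
      _ ≤ EReal.exp ε * (EReal.exp ε * liminf (expMoment μ t h) atTop) := by gcongr
      _ = _ := by rw [← mul_assoc, ← EReal.exp_add, ← EReal.coe_add, two_mul]
  have hlim : Tendsto (fun ε : ℝ => EReal.exp ((2 * ε : ℝ) : EReal) *
      liminf (expMoment μ t h) atTop) (𝓝[>] 0) (𝓝 (liminf (expMoment μ t h) atTop)) := by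
    have h1 : Tendsto (fun ε : ℝ => EReal.exp ((2 * ε : ℝ) : EReal)) (𝓝[>] 0) (𝓝 1) := by
      have h2 : Continuous fun ε : ℝ => EReal.exp ((2 * ε : ℝ) : EReal) :=
        ENNReal.continuous_exp.comp
          (continuous_coe_real_ereal.comp (continuous_const.mul continuous_id))
      simpa using (h2.tendsto 0).mono_left nhdsWithin_le_nhds
    simpa using ENNReal.Tendsto.mul_const h1 (Or.inl one_ne_zero)
  exact ge_of_tendsto hlim (eventually_mem_nhdsWithin.mono key)

/-- Chebyshev bound. -/
theorem log_limsup_le (ht_pos : ∀ i, 0 < t i) {h : X → ℝ} (hh : LambdaExists μ t h) {a : ℝ}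
    {B : Set X} (hB : MeasurableSet B) (ha : ∀ x ∈ B, a ≤ h x) :
    ENNReal.log (limsup (fun i => μ i B ^ t i) atTop) ≤ Lambda μ t h - a := by
  rw [EReal.le_sub_iff_add_le (by simp) (by simp), add_comm, ← EReal.exp_le_exp_iff,
    EReal.exp_add, ENNReal.exp_log, ← ENNReal.limsup_const_mul_of_ne_top (by simp),
    ← hh.tendsto.limsup_eq]
  exact limsup_le_limsup (Eventually.of_forall (exp_mul_measure_rpow_le_expMoment ht_pos hB ha))

/-- Smallness of the mass of `B` along cofinally many indices suffices, because the limit defining Λ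
is known to exist. This is how a liminf gets controlled by Λ. -/
theorem Lambda_le_of_liminf_lt [∀ i, IsProbabilityMeasure (μ i)] (ht_pos : ∀ i, 0 < t i)
    (ht : Tendsto t atTop (𝓝 0)) {h : X → ℝ} (hh : LambdaExists μ t h) {a b : ℝ}
    {B : Set X} (ha : ∀ x ∈ B, h x ≤ a) (hb : ∀ x ∉ B, h x ≤ b)
    (hB : ENNReal.log (liminf (fun i => μ i B ^ t i) atTop) < ((b - a : ℝ) : EReal)) :
    Lambda μ t h ≤ b := by
  rw [← EReal.exp_lt_exp_iff, ENNReal.exp_log] at hB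
  rw [← EReal.exp_le_exp_iff]
  refine le_of_tendsto_of_tendsto_of_frequently hh.tendsto (tendsto_two_rpow_mul ht) ?_
  exact (frequently_lt_of_liminf_lt (by isBoundedDefault) hB).mono fun i hi =>
    expMoment_le_two_rpow_mul ht_pos ha hb hi.le

end Moments

/-! ### Stone-Weierstrass on the one-point compactification -/

section Density

variable {X : Type*} [TopologicalSpace X]

/-- Extension by `0` of a function vanishing at infinity to the one-point compactification. -/
def extendZero [R1Space X] (f : C₀(X, ℝ)) : C(OnePoint X, ℝ) :=
  OnePoint.continuousMapMk f.toContinuousMap 0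
    (by rw [coclosedCompact_eq_cocompact]; exact f.zero_at_infty')

theorem extendZero_coe [R1Space X] (f : C₀(X, ℝ)) (x : X) :
    extendZero f (x : OnePoint X) = f x := rfl

theorem extendZero_infty [R1Space X] (f : C₀(X, ℝ)) :
    extendZero f (OnePoint.infty : OnePoint X) = 0 := rfl

/-- The functions on the one-point compactification of the form constant plus extension of an
element of `A`. -/
def unitalExtension [R1Space X] (A : NonUnitalSubalgebra ℝ C₀(X, ℝ)) :
    Subalgebra ℝ C(OnePoint X, ℝ) where
  carrier := {f | ∃ c : ℝ, ∃ a ∈ A, ∀ x, f x = c + extendZero a x}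
  mul_mem' := by
    rintro f g ⟨c, a, ha, hf⟩ ⟨d, b, hb, hg⟩
    refine ⟨c * d, c • b + d • a + a * b, A.add_mem (A.add_mem (SMulMemClass.smul_mem c hb)
      (SMulMemClass.smul_mem d ha)) (A.mul_mem ha hb), fun x => ?_⟩
    rw [ContinuousMap.mul_apply, hf, hg]
    cases x
    · simp [extendZero_infty]
    · simp only [extendZero_coe, ZeroAtInftyContinuousMap.add_apply,
        ZeroAtInftyContinuousMap.smul_apply, ZeroAtInftyContinuousMap.mul_apply, smul_eq_mul]
      ring
  add_mem' := by
    rintro f g ⟨c, a, ha, hf⟩ ⟨d, b, hb, hg⟩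
    refine ⟨c + d, a + b, A.add_mem ha hb, fun x => ?_⟩
    rw [ContinuousMap.add_apply, hf, hg]
    cases x
    · simp [extendZero_infty]
    · simp only [extendZero_coe, ZeroAtInftyContinuousMap.add_apply]
      ring
  algebraMap_mem' c := ⟨c, 0, A.zero_mem, fun x => by
    cases x
    · simp [extendZero_infty]
    · simp [extendZero_coe]⟩

/-- Stone-Weierstrass theorem for functions vanishing at infinity. -/
theorem exists_mem_near_of_separates [R1Space X] {A : NonUnitalSubalgebra ℝ C₀(X, ℝ)}
    (hsep : ∀ x y : X, x ≠ y → ∃ h ∈ A, h x ≠ h y) (hne : ∀ x : X, ∃ h ∈ A, h x ≠ 0)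
    (f : C₀(X, ℝ)) {ε : ℝ} (hε : 0 < ε) : ∃ g ∈ A, ∀ x, |f x - g x| ≤ ε := by
  have hmem : ∀ h ∈ A, extendZero h ∈ unitalExtension A := fun h hh =>
    ⟨0, h, hh, fun x => (zero_add _).symm⟩
  have hw : (unitalExtension A).SeparatesPoints := by
    intro x y hxy
    cases x <;> cases y
    · exact absurd rfl hxy
    · rename_i y
      -- Extensions vanish at infinity, so non-vanishing at `y` separates `y` from the added point.
      obtain ⟨h, hh, hy⟩ := hne y
      exact ⟨_, ⟨_, hmem h hh, rfl⟩, hy.symm⟩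
    · rename_i x
      obtain ⟨h, hh, hx⟩ := hne x
      exact ⟨_, ⟨_, hmem h hh, rfl⟩, hx⟩
    · rename_i x y
      obtain ⟨h, hh, hx⟩ := hsep x y fun e => hxy (by rw [e])
      exact ⟨_, ⟨_, hmem h hh, rfl⟩, hx⟩
  obtain ⟨⟨g, c, a, ha, hg⟩, hfg⟩ :=
    ContinuousMap.exists_mem_subalgebra_near_continuous_of_separatesPoints _ hw (extendZero f)
      (extendZero f).continuous (ε / 2) (half_pos hε)
  refine ⟨a, ha, fun x => ?_⟩
  -- At infinity this reads |c| < ε/2, so dropping the constant costs only the other ε/2.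
  have h1 := hfg OnePoint.infty
  have h2 := hfg x
  simp only [hg, extendZero_infty, extendZero_coe, Real.norm_eq_abs, abs_lt] at h1 h2
  rw [abs_le]
  constructor <;> linarith [h1.1, h1.2, h2.1, h2.2]

end Density

/-! ### Local rates at points and at infinity -/

section Rates

theorem exists_bump {X : Type*} [TopologicalSpace X] [RegularSpace X] [LocallyCompactSpace X]
    {K F : Set X} (hK : IsCompact K) (hF : IsClosed F) (hd : Disjoint K F) :
    ∃ f : C₀(X, ℝ), (∀ x ∈ K, f x = 1) ∧ (∀ x ∈ F, f x = 0) ∧ ∀ x, 0 ≤ f x ∧ f x ≤ 1 := by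
  obtain ⟨f, h1, h0, hc, hI⟩ := exists_continuous_one_zero_of_isCompact hK hF hd
  exact ⟨⟨f, hc.is_zero_at_infty⟩, h1, h0, hI⟩

variable {X ι : Type*} [TopologicalSpace X] [MeasurableSpace X] [Preorder ι]

/-- `sup_{h} (h(x) - Λ(h))` over all functions `h` vanishing at infinity. -/
noncomputable def fullRate (μ : ι → Measure X) (t : ι → ℝ) (x : X) : EReal :=
  ⨆ h : C₀(X, ℝ), ((h x : EReal) - Lambda μ t h)

/-- `sup_{h} (-Λ(h))` over all functions `h` vanishing at infinity: the exponential rate at which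
mass escapes to infinity. -/
noncomputable def escapeRate (μ : ι → Measure X) (t : ι → ℝ) : EReal :=
  ⨆ h : C₀(X, ℝ), -Lambda μ t h

variable {μ : ι → Measure X} {t : ι → ℝ}

theorem lowerSemicontinuous_fullRate : LowerSemicontinuous (fullRate μ t) := by
  refine lowerSemicontinuous_iSup fun h => Continuous.lowerSemicontinuous ?_
  refine continuous_iff_continuousAt.2 fun x => ?_
  simp only [sub_eq_add_neg]
  exact ContinuousAt.comp (f := fun y => ((h y : EReal), -Lambda μ t h))
    (EReal.continuousAt_add (by simp) (by simp))
    ((continuous_coe_real_ereal.comp h.continuous).continuousAt.prodMk continuousAt_const)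

variable [IsDirectedOrder ι] [Nonempty ι]

/-- Taking `φ` to be evaluation at a point or zero treats `rateFun` and the escape rate together. -/
theorem biSup_sub_Lambda_eq_iSup (ht_pos : ∀ i, 0 < t i) {A : NonUnitalSubalgebra ℝ C₀(X, ℝ)}
    (hA : ∀ f : C₀(X, ℝ), ∀ ε : ℝ, 0 < ε → ∃ g ∈ A, ∀ x, |f x - g x| ≤ ε)
    (hΛ : ∀ h : C₀(X, ℝ), LambdaExists μ t h) {φ : C₀(X, ℝ) → ℝ}
    (hφ : ∀ f g : C₀(X, ℝ), ∀ ε : ℝ, 0 < ε → (∀ x, |f x - g x| ≤ ε) → φ f ≤ φ g + ε) :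
    ⨆ h ∈ A, ((φ h : EReal) - Lambda μ t h) = ⨆ h : C₀(X, ℝ), ((φ h : EReal) - Lambda μ t h) := by
  refine le_antisymm (iSup₂_le fun h _ => le_iSup (fun h : C₀(X, ℝ) =>
    ((φ h : EReal) - Lambda μ t h)) h) (iSup_le fun f => ?_)
  refine EReal.ge_of_forall_gt_iff_ge.1 fun c hc => ?_
  obtain ⟨d, hcd, hd⟩ := EReal.lt_iff_exists_real_btwn.1 hc
  rw [EReal.coe_lt_coe_iff] at hcd
  -- Both `φ` and Λ may move by this amount, which together uses up the gap d - c.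
  have hε : 0 < (d - c) / 2 := by linarith
  obtain ⟨g, hg, hfg⟩ := hA f _ hε
  refine le_trans ?_ (le_iSup₂ (f := fun (h : C₀(X, ℝ)) (_ : h ∈ A) =>
    ((φ h : EReal) - Lambda μ t h)) g hg)
  have h1 := hφ f g _ hε hfg
  have h2 : Lambda μ t g ≤ (((d - c) / 2 : ℝ) : EReal) + Lambda μ t f :=
    Lambda_le_add ht_pos (hΛ g) (hΛ f) fun x => by linarith [(abs_le.1 (hfg x)).1]
  clear hφ
  revert hd h2
  generalize Lambda μ t f = u
  generalize Lambda μ t g = v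
  intro hd h2
  induction u <;> induction v <;> simp_all [← EReal.coe_add, ← EReal.coe_sub]
  linarith

theorem rateFun_eq_fullRate (ht_pos : ∀ i, 0 < t i) {A : NonUnitalSubalgebra ℝ C₀(X, ℝ)}
    (hA : ∀ f : C₀(X, ℝ), ∀ ε : ℝ, 0 < ε → ∃ g ∈ A, ∀ x, |f x - g x| ≤ ε)
    (hΛ : ∀ h : C₀(X, ℝ), LambdaExists μ t h) : rateFun μ t A = fullRate μ t :=
  funext fun x => biSup_sub_Lambda_eq_iSup ht_pos hA hΛ (φ := fun h => h x)
    fun _ _ _ _ h => by linarith [(abs_le.1 (h x)).2]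

theorem biSup_neg_Lambda_eq_escapeRate (ht_pos : ∀ i, 0 < t i)
    {A : NonUnitalSubalgebra ℝ C₀(X, ℝ)}
    (hA : ∀ f : C₀(X, ℝ), ∀ ε : ℝ, 0 < ε → ∃ g ∈ A, ∀ x, |f x - g x| ≤ ε)
    (hΛ : ∀ h : C₀(X, ℝ), LambdaExists μ t h) :
    ⨆ h ∈ A, -Lambda μ t h = escapeRate μ t := by
  have h := biSup_sub_Lambda_eq_iSup ht_pos hA hΛ (φ := fun _ => 0)
    fun _ _ ε hε _ => by linarith
  simpa [escapeRate] using h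

/-- Chebyshev applied to some `h` with h(x) - Λ(h) > b > a, on the open set where `h` has dropped by
less than b - a from its value at `x`. -/
theorem exists_isOpen_log_limsup_le [OpensMeasurableSpace X] (ht_pos : ∀ i, 0 < t i)
    (hΛ : ∀ h : C₀(X, ℝ), LambdaExists μ t h) {x : X} {a : ℝ} (ha : a < fullRate μ t x) :
    ∃ G, IsOpen G ∧ x ∈ G ∧
      ENNReal.log (limsup (fun i => μ i G ^ t i) atTop) ≤ ((-a : ℝ) : EReal) := by
  obtain ⟨h, hh⟩ := lt_iSup_iff.1 ha
  obtain ⟨b, hab, hb⟩ := EReal.lt_iff_exists_real_btwn.1 hh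
  rw [EReal.coe_lt_coe_iff] at hab
  have hG : IsOpen {y | h x - (b - a) < h y} := isOpen_lt continuous_const h.continuous
  refine ⟨_, hG, by simpa using hab, (log_limsup_le ht_pos (hΛ h) hG.measurableSet
    fun y hy => le_of_lt hy).trans ?_⟩
  revert hb
  generalize Lambda μ t h = u
  intro hb
  induction u <;> simp_all [← EReal.coe_sub, -EReal.coe_neg]
  linarith

/-- The same Chebyshev argument at infinity, where the value of `h` is 0. -/
theorem exists_isCompact_log_limsup_le [T2Space X] [OpensMeasurableSpace X]
    (ht_pos : ∀ i, 0 < t i) (hΛ : ∀ h : C₀(X, ℝ), LambdaExists μ t h) {a : ℝ}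
    (ha : a < escapeRate μ t) :
    ∃ K : Set X, IsCompact K ∧
      ENNReal.log (limsup (fun i => μ i Kᶜ ^ t i) atTop) ≤ ((-a : ℝ) : EReal) := by
  obtain ⟨h, hh⟩ := lt_iSup_iff.1 ha
  obtain ⟨b, hab, hb⟩ := EReal.lt_iff_exists_real_btwn.1 hh
  rw [EReal.coe_lt_coe_iff] at hab
  obtain ⟨K, hK, hKh⟩ := mem_cocompact.1
    (h.zero_at_infty'.eventually (lt_mem_nhds (show -(b - a) < 0 by linarith)))
  refine ⟨K, hK, (log_limsup_le ht_pos (hΛ h) hK.isClosed.isOpen_compl.measurableSet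
    fun y hy => le_of_lt (hKh hy)).trans ?_⟩
  calc Lambda μ t h - ((-(b - a) : ℝ) : EReal) ≤ ((-b : ℝ) : EReal) - ((-(b - a) : ℝ) : EReal) := by
        refine EReal.sub_le_sub ?_ le_rfl
        rw [EReal.coe_neg]
        exact (EReal.lt_neg_comm.1 hb).le
    _ = ((-a : ℝ) : EReal) := by
        rw [← EReal.coe_sub]
        congr 1
        ring

variable [∀ i, IsProbabilityMeasure (μ i)]

theorem fullRate_nonneg (x : X) : 0 ≤ fullRate μ t x :=
  le_iSup_of_le (0 : C₀(X, ℝ)) (by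
    have h : Lambda μ t (0 : C₀(X, ℝ)) = 0 := Lambda_zero
    simpa using h.le)

theorem escapeRate_nonneg : 0 ≤ escapeRate μ t :=
  le_iSup_of_le (0 : C₀(X, ℝ)) (by
    have h : Lambda μ t (0 : C₀(X, ℝ)) = 0 := Lambda_zero
    simpa using h.le)

theorem isLowerRegularization_fullRate :
    IsLowerRegularization (fullRate μ t) fun x => (fullRate μ t x).toENNReal :=
  ⟨⟨lowerSemicontinuous_fullRate, fun x => (EReal.coe_toENNReal (fullRate_nonneg x)).ge⟩,
    fun _ hg x => (hg.2 x).trans (EReal.coe_toENNReal (fullRate_nonneg x)).le⟩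

/-- If the mass of `G` has liminf below e^{-c}, then c times a bump at `x` vanishing off `G` has Λ ≤
0, so it witnesses a rate of at least c. -/
theorem neg_fullRate_le_log_liminf [RegularSpace X] [LocallyCompactSpace X]
    (ht_pos : ∀ i, 0 < t i) (ht : Tendsto t atTop (𝓝 0))
    (hΛ : ∀ h : C₀(X, ℝ), LambdaExists μ t h) {x : X} {G : Set X} (hG : IsOpen G) (hx : x ∈ G) :
    -fullRate μ t x ≤ ENNReal.log (liminf (fun i => μ i G ^ t i) atTop) := by
  rw [EReal.neg_le]
  refine EReal.ge_of_forall_gt_iff_ge.1 fun c hc => ?_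
  rcases le_or_gt c 0 with h0 | h0
  · exact le_trans (by exact_mod_cast h0) (fullRate_nonneg x)
  obtain ⟨f, hf1, hf0, hf⟩ := exists_bump (isCompact_singleton (x := x)) hG.isClosed_compl
    (by simpa using hx)
  have key : Lambda μ t (c • f : C₀(X, ℝ)) ≤ (0 : ℝ) := by
    refine Lambda_le_of_liminf_lt ht_pos ht (hΛ _) (a := c) (B := G) (fun y _ => ?_)
      (fun y hy => ?_) ?_
    · simpa using mul_le_of_le_one_right h0.le (hf y).2
    · simp [hf0 y hy]
    · rw [zero_sub, EReal.coe_neg]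
      exact EReal.lt_neg_comm.1 hc
  refine le_iSup_of_le (c • f) ?_
  have h1 : (c • f : C₀(X, ℝ)) x = c := by simp [hf1 x rfl]
  rw [h1]
  simpa using EReal.sub_le_sub (le_refl (c : EReal)) key

/-- Here the test function is -c times a bump equal to 1 on `K`: it is -c on `K` and at most 0
elsewhere, so little mass off `K` forces Λ ≤ -c. -/
theorem neg_escapeRate_le_log_liminf [RegularSpace X] [LocallyCompactSpace X]
    (ht_pos : ∀ i, 0 < t i) (ht : Tendsto t atTop (𝓝 0))
    (hΛ : ∀ h : C₀(X, ℝ), LambdaExists μ t h) {K : Set X} (hK : IsCompact K) :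
    -escapeRate μ t ≤ ENNReal.log (liminf (fun i => μ i Kᶜ ^ t i) atTop) := by
  rw [EReal.neg_le]
  refine EReal.ge_of_forall_gt_iff_ge.1 fun c hc => ?_
  rcases le_or_gt c 0 with h0 | h0
  · exact le_trans (by exact_mod_cast h0) escapeRate_nonneg
  obtain ⟨f, hf1, -, hf⟩ := exists_bump hK isClosed_empty (by simp)
  have key : Lambda μ t ((-c) • f : C₀(X, ℝ)) ≤ (-c : ℝ) := by
    refine Lambda_le_of_liminf_lt ht_pos ht (hΛ _) (a := 0) (B := Kᶜ) (fun y _ => ?_)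
      (fun y hy => ?_) ?_
    · simpa using mul_nonneg h0.le (hf y).1
    · simp [hf1 y (notMem_compl_iff.1 hy)]
    · rw [sub_zero, EReal.coe_neg]
      exact EReal.lt_neg_comm.1 hc
  refine le_iSup_of_le ((-c) • f) (EReal.le_neg.1 ?_)
  simpa using key

end Rates

/-! ### Large deviation bounds, uniqueness and tightness -/

section Principles

variable {X ι : Type*} [TopologicalSpace X] [MeasurableSpace X] [Preorder ι]
  [IsDirectedOrder ι] [Nonempty ι] {μ : ι → Measure X} {t : ι → ℝ}

/-- Sets obeying the bound are stable under subsets and finite unions, and the strict inequality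
gives each point of `K` a neighbourhood obeying it. -/
theorem log_limsup_le_of_isCompact [OpensMeasurableSpace X] (ht_pos : ∀ i, 0 < t i)
    (ht : Tendsto t atTop (𝓝 0)) (hΛ : ∀ h : C₀(X, ℝ), LambdaExists μ t h) {K : Set X}
    (hK : IsCompact K) {C : ℝ≥0∞} (hC : ∀ x ∈ K, -fullRate μ t x < ENNReal.log C) :
    limsup (fun i => μ i K ^ t i) atTop ≤ C := by
  refine hK.induction_on (p := fun s => limsup (fun i => μ i s ^ t i) atTop ≤ C) ?_ ?_ ?_ ?_
  · simp [ENNReal.zero_rpow_of_pos, ht_pos]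
  · refine fun s s' hs h => le_trans (limsup_le_limsup (Eventually.of_forall fun i => ?_)) h
    exact ENNReal.rpow_le_rpow (measure_mono hs) (ht_pos i).le
  · refine fun s s' h h' => le_trans (limsup_le_limsup (Eventually.of_forall fun i => ?_))
      (limsup_add_rpow_le ht_pos ht h h')
    exact ENNReal.rpow_le_rpow (measure_union_le _ _) (ht_pos i).le
  · intro x hx
    obtain ⟨a, ha, ha'⟩ := EReal.lt_iff_exists_real_btwn.1 (EReal.neg_lt_comm.1 (hC x hx))
    obtain ⟨G, hG, hxG, h⟩ := exists_isOpen_log_limsup_le ht_pos hΛ ha'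
    refine ⟨G, mem_nhdsWithin_of_mem_nhds (hG.mem_nhds hxG), ?_⟩
    rw [← ENNReal.log_le_log_iff]
    refine h.trans ?_
    rw [EReal.coe_neg]
    exact (EReal.neg_lt_comm.1 ha).le

theorem upperBounds_isCompact [OpensMeasurableSpace X] (ht_pos : ∀ i, 0 < t i)
    (ht : Tendsto t atTop (𝓝 0)) (hΛ : ∀ h : C₀(X, ℝ), LambdaExists μ t h) {K : Set X}
    (hK : IsCompact K) :
    limsup (fun i => μ i K ^ t i) atTop ≤ ⨆ x ∈ K, EReal.exp (-fullRate μ t x) := by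
  refine le_of_forall_gt_imp_ge_of_dense fun C hC =>
    log_limsup_le_of_isCompact ht_pos ht hΛ hK fun x hx => ?_
  rw [← EReal.exp_lt_exp_iff, ENNReal.exp_log]
  exact (le_iSup₂ (f := fun x (_ : x ∈ K) => EReal.exp (-fullRate μ t x)) x hx).trans_lt hC

theorem upperBounds_isClosed [T2Space X] [OpensMeasurableSpace X] (ht_pos : ∀ i, 0 < t i)
    (ht : Tendsto t atTop (𝓝 0)) (hΛ : ∀ h : C₀(X, ℝ), LambdaExists μ t h)
    (hS : ∀ x, fullRate μ t x ≤ escapeRate μ t) {F : Set X} (hF : IsClosed F) :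
    limsup (fun i => μ i F ^ t i) atTop ≤ ⨆ x ∈ F, EReal.exp (-fullRate μ t x) := by
  rcases F.eq_empty_or_nonempty with rfl | ⟨x₀, hx₀⟩
  · simp [ENNReal.zero_rpow_of_pos, ht_pos]
  refine le_of_forall_gt_imp_ge_of_dense fun C hC => ?_
  have hJ : ∀ x ∈ F, -fullRate μ t x < ENNReal.log C := fun x hx => by
    rw [← EReal.exp_lt_exp_iff, ENNReal.exp_log]
    exact (le_iSup₂ (f := fun x (_ : x ∈ F) => EReal.exp (-fullRate μ t x)) x hx).trans_lt hC
  -- Here condition (1) enters: -log C < J(x₀) ≤ `escapeRate`, so the mass off some compact set is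
  -- already below the level C.
  obtain ⟨a, ha, ha'⟩ := EReal.lt_iff_exists_real_btwn.1
    ((EReal.neg_lt_comm.1 (hJ x₀ hx₀)).trans_le (hS x₀))
  obtain ⟨K, hK, h⟩ := exists_isCompact_log_limsup_le ht_pos hΛ ha'
  have h1 : limsup (fun i => μ i Kᶜ ^ t i) atTop ≤ C := by
    rw [← ENNReal.log_le_log_iff]
    refine h.trans ?_
    rw [EReal.coe_neg]
    exact (EReal.neg_lt_comm.1 ha).le
  refine le_trans (limsup_le_limsup (Eventually.of_forall fun i => ?_))
    (limsup_add_rpow_le ht_pos ht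
      (log_limsup_le_of_isCompact ht_pos ht hΛ (hK.inter_left hF) fun x hx => hJ x hx.1) h1)
  refine ENNReal.rpow_le_rpow ((measure_mono fun x hx => ?_).trans (measure_union_le _ _))
    (ht_pos i).le
  by_cases hxK : x ∈ K
  · exact Or.inl ⟨hx, hxK⟩
  · exact Or.inr hxK

variable [∀ i, IsProbabilityMeasure (μ i)] [RegularSpace X] [LocallyCompactSpace X]

theorem lowerBounds_fullRate (ht_pos : ∀ i, 0 < t i) (ht : Tendsto t atTop (𝓝 0))
    (hΛ : ∀ h : C₀(X, ℝ), LambdaExists μ t h) :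
    LowerBounds μ t fun x => (fullRate μ t x).toENNReal := by
  refine fun G hG => iSup₂_le fun x hx => ?_
  rw [EReal.coe_toENNReal (fullRate_nonneg x), ← ENNReal.log_le_log_iff, EReal.log_exp]
  exact neg_fullRate_le_log_liminf ht_pos ht hΛ hG hx

theorem vagueLDP_fullRate [OpensMeasurableSpace X] (ht_pos : ∀ i, 0 < t i)
    (ht : Tendsto t atTop (𝓝 0)) (hΛ : ∀ h : C₀(X, ℝ), LambdaExists μ t h) :
    VagueLDP μ t (fullRate μ t) := by
  refine ⟨_, fun K hK => ?_, lowerBounds_fullRate ht_pos ht hΛ, isLowerRegularization_fullRate⟩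
  simp only [EReal.coe_toENNReal (fullRate_nonneg _)]
  exact upperBounds_isCompact ht_pos ht hΛ hK

theorem ldp_fullRate [T2Space X] [OpensMeasurableSpace X] (ht_pos : ∀ i, 0 < t i)
    (ht : Tendsto t atTop (𝓝 0)) (hΛ : ∀ h : C₀(X, ℝ), LambdaExists μ t h)
    (hS : ∀ x, fullRate μ t x ≤ escapeRate μ t) : LDP μ t (fullRate μ t) := by
  refine ⟨_, fun F hF => ?_, lowerBounds_fullRate ht_pos ht hΛ, isLowerRegularization_fullRate⟩
  simp only [EReal.coe_toENNReal (fullRate_nonneg _)]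
  exact upperBounds_isClosed ht_pos ht hΛ hS hF

/-- For a below the escape rate, some open Kᶜ decays at rate at least a. It is a neighbourhood of
each of its points, so their rates are at least a too. -/
theorem escapeRate_le_iSup_iInf_fullRate [T2Space X] [OpensMeasurableSpace X]
    (ht_pos : ∀ i, 0 < t i) (ht : Tendsto t atTop (𝓝 0))
    (hΛ : ∀ h : C₀(X, ℝ), LambdaExists μ t h) :
    escapeRate μ t ≤ ⨆ K ∈ {K : Set X | IsCompact K}, ⨅ x ∈ Kᶜ, fullRate μ t x := by
  refine EReal.ge_of_forall_gt_iff_ge.1 fun a ha => ?_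
  obtain ⟨K, hK, h⟩ := exists_isCompact_log_limsup_le ht_pos hΛ ha
  refine le_iSup₂_of_le K hK (le_iInf₂ fun x hx => ?_)
  rw [← EReal.neg_le_neg_iff, ← EReal.coe_neg]
  exact ((neg_fullRate_le_log_liminf ht_pos ht hΛ hK.isClosed.isOpen_compl hx).trans
    (ENNReal.log_le_log liminf_le_limsup)).trans h

/-- Regularity gives a closed neighbourhood on which J > a, where (U) meets the bump lower bound.
Conversely, (L) on Chebyshev neighbourhoods gives `fullRate` ≤ l, and maximality of the
regularization concludes. -/
theorem LDP.eq_fullRate [OpensMeasurableSpace X] (ht_pos : ∀ i, 0 < t i)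
    (ht : Tendsto t atTop (𝓝 0)) (hΛ : ∀ h : C₀(X, ℝ), LambdaExists μ t h) {J : X → EReal}
    (hJ : LDP μ t J) :
    J = fullRate μ t := by
  obtain ⟨l, hU, hL, hJl⟩ := hJ
  refine le_antisymm (fun x => ?_) (hJl.2 ⟨lowerSemicontinuous_fullRate, fun x => ?_⟩)
  · refine EReal.ge_of_forall_gt_iff_ge.1 fun a ha => ?_
    obtain ⟨F, ⟨hFx, hF⟩, hFJ⟩ := (closed_nhds_basis x).mem_iff.1 (hJl.1.1 x a ha)
    rw [← EReal.neg_le_neg_iff]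
    refine (neg_fullRate_le_log_liminf ht_pos ht hΛ isOpen_interior
      (mem_interior_iff_mem_nhds.2 hFx)).trans ?_
    rw [← EReal.exp_le_exp_iff, ENNReal.exp_log]
    calc _ ≤ limsup (fun i => μ i (interior F) ^ t i) atTop := liminf_le_limsup
      _ ≤ limsup (fun i => μ i F ^ t i) atTop :=
          limsup_le_limsup (Eventually.of_forall fun i =>
            ENNReal.rpow_le_rpow (measure_mono interior_subset) (ht_pos i).le)
      _ ≤ _ := hU F hF
      _ ≤ _ := iSup₂_le fun y hy => EReal.exp_monotone
          (EReal.neg_le_neg_iff.2 ((le_of_lt (hFJ hy)).trans (hJl.1.2 y)))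
  · refine EReal.ge_of_forall_gt_iff_ge.1 fun a ha => ?_
    obtain ⟨G, hG, hx, h⟩ := exists_isOpen_log_limsup_le ht_pos hΛ ha
    rw [← EReal.neg_le_neg_iff, ← EReal.coe_neg]
    refine le_trans ?_ ((ENNReal.log_le_log liminf_le_limsup).trans h)
    rw [← EReal.exp_le_exp_iff, ENNReal.exp_log]
    exact (le_iSup₂ (f := fun x (_ : x ∈ G) => EReal.exp (-(l x : EReal))) x hx).trans (hL G hG)

theorem LDP.iInf_compl_le_escapeRate (ht_pos : ∀ i, 0 < t i) (ht : Tendsto t atTop (𝓝 0))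
    (hΛ : ∀ h : C₀(X, ℝ), LambdaExists μ t h) {J : X → EReal} (hJ : LDP μ t J) {K : Set X}
    (hK : IsCompact K) : ⨅ x ∈ Kᶜ, J x ≤ escapeRate μ t := by
  obtain ⟨l, hU, -, hJl⟩ := hJ
  -- (U) needs a closed set: the complement of the interior of `K'` is closed, contains K'ᶜ and lies
  -- in Kᶜ.
  obtain ⟨K', hK', hKK'⟩ := exists_compact_superset hK
  rw [← EReal.neg_le_neg_iff]
  refine (neg_escapeRate_le_log_liminf ht_pos ht hΛ hK').trans ?_
  rw [← EReal.exp_le_exp_iff, ENNReal.exp_log]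
  calc _ ≤ limsup (fun i => μ i K'ᶜ ^ t i) atTop := liminf_le_limsup
    _ ≤ limsup (fun i => μ i (interior K')ᶜ ^ t i) atTop :=
        limsup_le_limsup (Eventually.of_forall fun i => ENNReal.rpow_le_rpow
          (measure_mono (compl_subset_compl.2 interior_subset)) (ht_pos i).le)
    _ ≤ _ := hU _ isOpen_interior.isClosed_compl
    _ ≤ _ := iSup₂_le fun y hy => EReal.exp_monotone (EReal.neg_le_neg_iff.2
        ((iInf₂_le y (compl_subset_compl.2 hKK' hy)).trans (hJl.1.2 y)))

theorem expTight_iff_escapeRate_eq_top [T2Space X] [OpensMeasurableSpace X]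
    (ht_pos : ∀ i, 0 < t i) (ht : Tendsto t atTop (𝓝 0))
    (hΛ : ∀ h : C₀(X, ℝ), LambdaExists μ t h) : ExpTight μ t ↔ escapeRate μ t = ⊤ := by
  constructor
  · refine fun h => top_le_iff.1 (EReal.ge_of_forall_gt_iff_ge.1 fun a _ => ?_)
    obtain ⟨K, hK, hKa⟩ := h (EReal.exp ((-a : ℝ) : EReal)) 
      (EReal.zero_lt_exp_iff.2 (EReal.bot_lt_coe _))
    rw [← EReal.neg_le_neg_iff, ← EReal.coe_neg]
    refine (neg_escapeRate_le_log_liminf ht_pos ht hΛ hK).trans ?_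
    rw [← EReal.exp_le_exp_iff, ENNReal.exp_log]
    exact (le_trans liminf_le_limsup hKa.le :)
  · intro h ε hε
    obtain ⟨a, -, ha⟩ := EReal.lt_iff_exists_real_btwn.1 (ENNReal.bot_lt_log_iff.2 hε)
    obtain ⟨K, hK, hKa⟩ := exists_isCompact_log_limsup_le ht_pos hΛ (a := -a)
      (h ▸ EReal.coe_lt_top _)
    refine ⟨K, hK, ?_⟩
    rw [← ENNReal.log_lt_log_iff]
    exact (hKa.trans_eq (by simp)).trans_lt ha

end Principles

end LargeDev

/-! ### Reduction from `A` to C₀(X) and conclusion -/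

theorem mainTheorem2 {X ι : Type*} [TopologicalSpace X] [WeaklyLocallyCompactSpace X]
    [RegularSpace X] [MeasurableSpace X] [BorelSpace X]
    [Preorder ι] [IsDirectedOrder ι] [Nonempty ι]
    (μ : ι → Measure X) [∀ i, IsProbabilityMeasure (μ i)]
    (t : ι → ℝ) (ht_pos : ∀ i, 0 < t i) (ht : Tendsto t atTop (𝓝 0))
    (A : NonUnitalSubalgebra ℝ C₀(X, ℝ))
    (hsep : ∀ x y : X, x ≠ y → ∃ h ∈ A, h x ≠ h y)
    (hne : ∀ x : X, ∃ h ∈ A, h x ≠ 0)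
    (hΛ : ∀ h ∈ A, LargeDev.LambdaExists μ t h) :
    -- (a)
    (LargeDev.VagueLDP μ t (LargeDev.rateFun μ t A) ∧
      (LargeDev.SupCondition μ t A →
        LargeDev.LDP μ t (LargeDev.rateFun μ t A) ∧
          LargeDev.WeakTight (LargeDev.rateFun μ t A))) ∧
    -- (b)
    (T2Space X → ∀ J : X → EReal, LargeDev.LDP μ t J →
      J = LargeDev.rateFun μ t A ∧
        (LargeDev.WeakTight J → LargeDev.SupCondition μ t A)) ∧
    -- (c)
    (LargeDev.ExpTight μ t ↔ ⨆ h ∈ A, -LargeDev.Lambda μ t h = (⊤ : EReal)) := by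
  -- Evaluation on `A` maps X injectively and continuously into a power of ℝ.
  have : T2Space X := T2Space.of_injective_continuous (f := fun (x : X) (h : A) => h.1 x)
    (fun x y hxy => by
      by_contra hne'
      obtain ⟨h, hh, hx⟩ := hsep x y hne'
      exact hx (congrFun hxy ⟨h, hh⟩))
    (continuous_pi fun h => h.1.continuous)
  have hA : ∀ f : C₀(X, ℝ), ∀ ε : ℝ, 0 < ε → ∃ g ∈ A, ∀ x, |f x - g x| ≤ ε :=
    fun f _ hε => LargeDev.exists_mem_near_of_separates hsep hne f hε
  have hΛ' : ∀ h : C₀(X, ℝ), LargeDev.LambdaExists μ t h := fun h =>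
    LargeDev.LambdaExists.of_approx ht_pos fun ε hε => by
      obtain ⟨g, hg, hgx⟩ := hA h ε hε
      exact ⟨g, hΛ g hg, hgx⟩
  have hJ := LargeDev.rateFun_eq_fullRate ht_pos hA hΛ'
  have hS := LargeDev.biSup_neg_Lambda_eq_escapeRate ht_pos hA hΛ'
  have hcond : LargeDev.SupCondition μ t A ↔
      ⨆ x, LargeDev.fullRate μ t x ≤ LargeDev.escapeRate μ t := by
    rw [← hJ, ← hS]
    rfl
  rw [hcond, hJ, hS]
  refine ⟨⟨LargeDev.vagueLDP_fullRate ht_pos ht hΛ', fun h =>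
    ⟨LargeDev.ldp_fullRate ht_pos ht hΛ' fun x => (le_iSup _ x).trans h,
      h.trans (LargeDev.escapeRate_le_iSup_iInf_fullRate ht_pos ht hΛ')⟩⟩,
    fun _ J hLDP => ?_, LargeDev.expTight_iff_escapeRate_eq_top ht_pos ht hΛ'⟩
  have hJ' := hLDP.eq_fullRate ht_pos ht hΛ'
  refine ⟨hJ', fun hW => ?_⟩
  rw [← hJ']
  exact hW.trans (iSup₂_le fun K hK => hLDP.iInf_compl_le_escapeRate ht_pos ht hΛ' hK)
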